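/- All graphs are locally finite and simple (no loops, no multiple edges); $x\sim y$ denotes adjacency, $d_x$ the degree of $x$, and $d(x,y)$ the combinatorial distance. For $p\in[0,1]$ and a vertex $x$ with $d_x\geq 1$, let $\mu_x^p$ be the probability measure with $\mu_x^p(x)=p$, $\mu_x^p(z)=\frac{1-p}{d_x}$ for $z\sim x$, and $\mu_x^p(z)=0$ otherwise. Let $W_1(\mu_1,\mu_2)=\inf_\pi\sum_{y}\sum_{x}d(x,y)\pi(x,y)$ be the $1$-Wasserstein distance, where the infimum is over all $\pi:V\times V\to[0,1]$ with marginals $\mu_1$ and $\mu_2$. For an edge $x\sim y$ put $$\kappa_p(x,y)=1-W_1(\mu_x^p,\mu_y^p),\qquad \kappa(x,y)=\lim_{p\to 1^-}\frac{\kappa_p(x,y)}{1-p}.$$ **Corollary.** Let $G=(V_G,E_G)$ be a $d_G$-regular graph and $H=(V_H,E_H)$ a $d_H$-regular graph, and let $G\times H$ be their Cartesian product. Let $x_1,x_2\in V_G$ with $x_1\sim x_2$ and let $y\in V_H$. Then the limit defining $\kappa^G(x_1,x_2)$ exists, and $$\kappa^{G\times H}_{p}((x_1,y),(x_2,y))=\begin{cases}\frac{d_G}{d_G+d_H}\,\kappa^G_p(x_1,x_2)+\frac{d_Gd_H}{d_G+d_H}\left(\kappa^G(x_1,x_2)-\kappa^G_0(x_1,x_2)\right)p,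 & \text{if } p\in\left[0,\frac{1}{d_G+d_H+1}\right],\\[2mm] \frac{d_G}{d_G+d_H}\,\kappa^G(x_1,x_2)\,(1-p), & \text{if } p\in\left[\frac{1}{d_G+d_H+1},1\right].\end{cases}$$ -/

import Mathlib

open Filter Topology Set
open scoped ENNReal

noncomputable section

namespace OllivierRicci

variable {V : Type*}

open Classical in
/-- The probability measure `μ_x^p` with idleness `p ∈ [0, 1]` at a (non-isolated) vertex `x`,
given by its mass function: mass `p` at `x`, mass `(1 - p) / d_x` at each neighbour of `x`. -/
def idleMeasure (G : SimpleGraph V) [G.LocallyFinite] (p : ℝ) (x : V) : V → ℝ := fun z =>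
  if z = x then p else if G.Adj x z then (1 - p) / (G.degree x : ℝ) else 0

/-- The transport plans `π : V × V → [0, 1]` between two probability measures on `V`,
which are given by their mass functions `μ₁` and `μ₂`. -/
def transportPlans (μ₁ μ₂ : V → ℝ) : Set (V → V → ℝ) :=
  {π | (∀ x y, π x y ∈ Icc (0 : ℝ) 1) ∧
    (∀ x, HasSum (fun y => π x y) (μ₁ x)) ∧
    (∀ y, HasSum (fun x => π x y) (μ₂ y))}

/-- The cost of a transport plan for the combinatorial distance of `G`. The sum is
taken in `[0, ∞]`, and the distance between different components is `∞`. -/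
def transportCost (G : SimpleGraph V) (π : V → V → ℝ) : ℝ≥0∞ :=
  ∑' y, ∑' x, (G.edist x y : ℝ≥0∞) * ENNReal.ofReal (π x y)

/-- The `1`-Wasserstein distance between two probability measures on the vertices of `G`. -/
def wasserstein (G : SimpleGraph V) (μ₁ μ₂ : V → ℝ) : ℝ≥0∞ :=
  ⨅ π ∈ transportPlans μ₁ μ₂, transportCost G π

/-- The `p`-Ollivier-Ricci curvature `κ_p(x, y) = 1 - W₁(μ_x^p, μ_y^p)` of an edge `x ∼ y`
(where the Wasserstein distance is finite). -/
def ollivierRicci (G : SimpleGraph V) [G.LocallyFinite] (p : ℝ) (x y : V) : ℝ :=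
  1 - (wasserstein G (idleMeasure G p x) (idleMeasure G p y)).toReal

/-- The Lin-Lu-Yau curvature `κ(x, y)`, the limit of `κ_p(x, y) / (1 - p)` as `p → 1` in
`[0, 1)`. -/
def linLuYau (G : SimpleGraph V) [G.LocallyFinite] (x y : V) : ℝ :=
  limUnder (𝓝[<] (1 : ℝ)) (fun p : ℝ => ollivierRicci G p x y / (1 - p))

/-- The Cartesian product of two locally finite graphs is locally finite. -/
instance boxProdLocallyFinite {W : Type*} (G : SimpleGraph V) (H : SimpleGraph W)
    [G.LocallyFinite] [H.LocallyFinite] : (G □ H).LocallyFinite :=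
  fun v => SimpleGraph.boxProdFintypeNeighborSet v

end OllivierRicci

end

namespace OllivierRicci

/-! By Kantorovich-Rubinstein duality (`isLUB_wasserstein`), `1 - κ_p` on an edge `x ∼ y` of a
`d`-regular graph is the supremum over 1-Lipschitz `φ` of `(1-p)/d * ballSum φ + (p - (1-p)/d) * (φ
x - φ y)`. The second coefficient changes sign at `p = 1/(d+1)`.

Above this value a large drop `φ x - φ y` is favoured. Any potential can be given the maximal drop 1
without lowering `ballSum` (`EdgeLipschitz.exists_sub_eq_one`), so only the supremum of `ballSum`
matters and `κ_p` is a multiple of `1 - p`. This also yields the limit `κ`.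

Below it the functional is a nonnegative combination of `ballSum` and `ballSum - drop`, the latter
being `d` times the problem at `p = 0`. The supremum of the sum is at most the sum of the suprema.
For equality, potentials are rounded to integers by a randomly shifted floor, and an integrality
argument produces one potential serving both problems (`exists_ballSum_sub_mul_ge`). Hence `κ_p` is
affine there.

In the product, `c` is the mass of the measure at `(x₁, y)` on the fibre over `y`, and `q = p/c` is
its idleness after normalisation. The mass outside this fibre travels exactly distance 1, so `κ_p`
of the product is `c * κ_q` of `G` (`ollivierRicci_boxProd`). The map from `p` to `q` carries
`1/(dG+dH+1)` to `1/(dG+1)`, and the formula follows by substitution. -/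

variable {V : Type*}

/-! ### Linear programming duality on finite sets -/

/-- Finite Kantorovich duality: a bound for all dual pairs is a bound for the cost of some
coupling. -/
theorem exists_coupling_of_dual_le {α β : Type*} [Fintype α] [Fintype β]
    (c : α → β → ℝ) (μ : α → ℝ) (ν : β → ℝ) (M : ℝ)
    (hμ : ∀ a, 0 ≤ μ a) (hν : ∀ b, 0 ≤ ν b) (sμ : ∑ a, μ a = 1) (sν : ∑ b, ν b = 1)
    (h : ∀ (φ : α → ℝ) (ψ : β → ℝ), (∀ a b, φ a + ψ b ≤ c a b) →
      ∑ a, φ a * μ a + ∑ b, ψ b * ν b ≤ M) :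
    ∃ π : α → β → ℝ, (∀ a b, 0 ≤ π a b) ∧ (∀ a, ∑ b, π a b = μ a) ∧
      (∀ b, ∑ a, π a b = ν b) ∧ ∑ a, ∑ b, c a b * π a b ≤ M := by
  classical
  -- In essence the epigraph of the sublinear functional taking `u` to the infimum of `∑ φ μ + ∑ ψ ν
  -- + r M` over `u ≤ φ + ψ + r c`, `r ≥ 0`. A linear functional below it is integration against a
  -- coupling of cost at most `M`; Riesz extension supplies one.
  let s : PointedCone ℝ ((α × β → ℝ) × ℝ) :=
    { carrier := {u | ∃ (φ : α → ℝ) (ψ : β → ℝ) (r : ℝ), 0 ≤ r ∧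
        (∀ a b, u.1 (a, b) ≤ φ a + ψ b + r * c a b) ∧
        ∑ a, φ a * μ a + ∑ b, ψ b * ν b + r * M ≤ u.2}
      smul_mem' := by
        rintro ⟨k, hk⟩ u ⟨φ, ψ, r, hr, h1, h2⟩
        refine ⟨fun a => k * φ a, fun b => k * ψ b, k * r, by positivity, fun a b => ?_, ?_⟩
        · have := mul_le_mul_of_nonneg_left (h1 a b) hk
          change k * u.1 (a, b) ≤ _
          linarith
        · have := mul_le_mul_of_nonneg_left h2 hk
          change _ ≤ k * u.2
          simp only [mul_assoc, ← Finset.mul_sum]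
          linarith
      zero_mem' := ⟨0, 0, 0, le_rfl, by simp, by simp⟩
      add_mem' := by
        rintro u v ⟨φ, ψ, r, hr, h1, h2⟩ ⟨φ', ψ', r', hr', h1', h2'⟩
        refine ⟨fun a => φ a + φ' a, fun b => ψ b + ψ' b, r + r', by positivity,
          fun a b => ?_, ?_⟩
        · have := h1 a b
          have := h1' a b
          simp only [Prod.fst_add, Pi.add_apply]
          linarith
        · simp only [Prod.snd_add, add_mul, Finset.sum_add_distrib]
          linarith }
  have hs : ∀ u, u ∈ s ↔ ∃ (φ : α → ℝ) (ψ : β → ℝ) (r : ℝ), 0 ≤ r ∧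
        (∀ a b, u.1 (a, b) ≤ φ a + ψ b + r * c a b) ∧
        ∑ a, φ a * μ a + ∑ b, ψ b * ν b + r * M ≤ u.2 := fun u => Iff.rfl
  let f : ((α × β → ℝ) × ℝ) →ₗ.[ℝ] ℝ :=
    { domain := LinearMap.range (LinearMap.inr ℝ (α × β → ℝ) ℝ)
      toFun := (LinearMap.snd ℝ (α × β → ℝ) ℝ).comp (Submodule.subtype _) }
  obtain ⟨g, hg, hpos⟩ := riesz_extension s f (by
      rintro ⟨_, v, rfl⟩ hv
      obtain ⟨φ, ψ, r, hr, h1, h2⟩ := (hs _).1 hv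
      change (0 : ℝ) ≤ v
      simp only [LinearMap.inr_apply, Pi.zero_apply] at h1 h2
      refine le_trans ?_ h2
      -- For `r = 0`, average `0 ≤ φ + ψ` against the product measure; for `r > 0`, the pair `-φ/r`,
      -- `-ψ/r` is admissible in `h`.
      rcases hr.eq_or_lt with rfl | hr
      · have e : ∑ a, φ a * μ a + ∑ b, ψ b * ν b =
            ∑ a, ∑ b, (φ a + ψ b) * (μ a * ν b) := by
          have e1 : ∑ a, φ a * μ a = ∑ a, ∑ b, φ a * (μ a * ν b) := by
            refine Finset.sum_congr rfl fun a _ => ?_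
            rw [← Finset.mul_sum, ← Finset.mul_sum, sν, mul_one]
          have e2 : ∑ b, ψ b * ν b = ∑ a, ∑ b, ψ b * (μ a * ν b) := by
            rw [Finset.sum_comm]
            refine Finset.sum_congr rfl fun b _ => ?_
            rw [← Finset.mul_sum, ← Finset.sum_mul, sμ, one_mul]
          rw [e1, e2, ← Finset.sum_add_distrib]
          refine Finset.sum_congr rfl fun a _ => ?_
          rw [← Finset.sum_add_distrib]
          exact Finset.sum_congr rfl fun b _ => by ring
        rw [e, zero_mul, add_zero]
        refine Finset.sum_nonneg fun a _ => Finset.sum_nonneg fun b _ => ?_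
        have := h1 a b
        exact mul_nonneg (by linarith) (mul_nonneg (hμ a) (hν b))
      · have := h (fun a => -(φ a / r)) (fun b => -(ψ b / r)) (fun a b => by
          have := h1 a b
          rw [← sub_nonneg]
          have e : c a b - (-(φ a / r) + -(ψ b / r)) = (φ a + ψ b + r * c a b) / r := by
            field_simp; ring
          rw [e]; positivity)
        have e : ∑ a, -(φ a / r) * μ a + ∑ b, -(ψ b / r) * ν b =
            -(∑ a, φ a * μ a + ∑ b, ψ b * ν b) / r := by
          rw [neg_add, add_div, ← Finset.sum_neg_distrib, ← Finset.sum_neg_distrib,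
            Finset.sum_div, Finset.sum_div]
          congr 1 <;> exact Finset.sum_congr rfl fun _ _ => by ring
        rw [e, div_le_iff₀ hr] at this
        linarith) (by
      rintro ⟨u, v⟩
      refine ⟨⟨_, ∑ j, |u j| - v, rfl⟩, (hs _).2 ⟨fun _ => ∑ j, |u j|, 0, 0, le_rfl,
        fun a b => ?_, ?_⟩⟩
      · have := Finset.single_le_sum (f := fun j => |u j|) (fun j _ => abs_nonneg _)
          (Finset.mem_univ (a, b))
        have := le_abs_self (u (a, b))
        simp
        linarith
      · simp [← Finset.mul_sum, sμ])
  let T : (α × β → ℝ) →ₗ[ℝ] ℝ := -(g.comp (LinearMap.inl ℝ _ _))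
  have hT : ∀ (u : α × β → ℝ) (φ : α → ℝ) (ψ : β → ℝ) (r : ℝ), 0 ≤ r →
      (∀ a b, u (a, b) ≤ φ a + ψ b + r * c a b) →
      T u ≤ ∑ a, φ a * μ a + ∑ b, ψ b * ν b + r * M := by
    intro u φ ψ r hr hu
    have h0 := hpos (u, ∑ a, φ a * μ a + ∑ b, ψ b * ν b + r * M) ((hs _).2
      ⟨φ, ψ, r, hr, hu, le_rfl⟩)
    have h1 := hg ⟨_, ∑ a, φ a * μ a + ∑ b, ψ b * ν b + r * M, rfl⟩
    have h2 : (u, ∑ a, φ a * μ a + ∑ b, ψ b * ν b + r * M) =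
      LinearMap.inl ℝ (α × β → ℝ) ℝ u + LinearMap.inr ℝ (α × β → ℝ) ℝ
        (∑ a, φ a * μ a + ∑ b, ψ b * ν b + r * M) := by simp
    rw [h2, map_add, h1] at h0
    change 0 ≤ g (LinearMap.inl ℝ (α × β → ℝ) ℝ u) +
      (∑ a, φ a * μ a + ∑ b, ψ b * ν b + r * M) at h0
    change -(g (LinearMap.inl ℝ (α × β → ℝ) ℝ u)) ≤ _
    linarith
  have hsum : ∀ u : α × β → ℝ, T u =
      ∑ a, ∑ b, u (a, b) * T (fun j => if (a, b) = j then 1 else 0) := by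
    intro u
    rw [LinearMap.pi_apply_eq_sum_univ T u, Fintype.sum_prod_type]
    rfl
  -- The coupling is `T` on point indicators. Sign, marginals and cost come from testing `hT` on
  -- negated point indicators, on plus and minus row or column indicators, and on `c`.
  refine ⟨fun a b => T (fun j => if (a, b) = j then 1 else 0), fun a b => ?_, fun a => ?_,
    fun b => ?_, ?_⟩
  · have := hT (-(fun j => if (a, b) = j then 1 else 0)) 0 0 0 le_rfl (fun a' b' => by
      simp only [Pi.neg_apply, Pi.zero_apply]
      split_ifs <;> norm_num)
    rw [map_neg] at this
    simp at this
    exact this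
  · have e := hsum (fun j => if j.1 = a then 1 else 0)
    have e' : ∑ a', ∑ b, (if a' = a then (1 : ℝ) else 0) *
        T (fun j => if (a', b) = j then 1 else 0) =
        ∑ b, T (fun j => if (a, b) = j then 1 else 0) := by
      rw [Finset.sum_eq_single a] <;> simp +contextual
    rw [← e', ← e]
    apply le_antisymm
    · have := hT (fun j => if j.1 = a then 1 else 0) (fun i => if i = a then 1 else 0) 0 0 le_rfl
        (fun a' b' => by simp)
      simpa using this
    · have := hT (-fun j => if j.1 = a then 1 else 0) (fun i => -if i = a then 1 else 0) 0 0 le_rfl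
        (fun a' b' => by simp)
      rw [map_neg] at this
      simpa using this
  · have e := hsum (fun j => if j.2 = b then 1 else 0)
    have e' : ∑ a, ∑ b', (if b' = b then (1 : ℝ) else 0) *
        T (fun j => if (a, b') = j then 1 else 0) =
        ∑ a, T (fun j => if (a, b) = j then 1 else 0) := by
      simp
    rw [← e', ← e]
    apply le_antisymm
    · have := hT (fun j => if j.2 = b then 1 else 0) 0 (fun i => if i = b then 1 else 0) 0 le_rfl
        (fun a' b' => by simp)
      simpa using this
    · have := hT (-fun j => if j.2 = b then 1 else 0) 0 (fun i => -if i = b then 1 else 0) 0 le_rfl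
        (fun a' b' => by simp)
      rw [map_neg] at this
      simpa using this
  · have := hT (fun j => c j.1 j.2) 0 0 1 zero_le_one (fun a b => by simp)
    rw [hsum] at this
    simpa using this

/-! ### Kantorovich-Rubinstein duality on graphs -/

/-- Real functions on the vertices which change by at most `1` along edges. -/
def EdgeLipschitz (G : SimpleGraph V) (φ : V → ℝ) : Prop :=
  ∀ a b, G.Adj a b → φ a ≤ φ b + 1

theorem EdgeLipschitz.sub_le_dist {G : SimpleGraph V} {φ : V → ℝ} (hφ : EdgeLipschitz G φ)
    {a b : V} (h : G.Reachable a b) : φ a - φ b ≤ G.dist a b := by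
  obtain ⟨w, hw⟩ := h.exists_walk_length_eq_dist
  rw [← hw]
  clear hw h
  induction w with
  | nil => simp
  | cons hadj w ih =>
    have := hφ _ _ hadj
    rw [SimpleGraph.Walk.length_cons]
    push_cast
    linarith

theorem dist_le_dist_add_one {G : SimpleGraph V} (o : V) {a b : V} (h : G.Adj a b) :
    (G.dist o a : ℝ) ≤ G.dist o b + 1 := by
  have : G.dist o a ≤ G.dist o b + 1 := by
    have := h.reachable.dist_triangle_right o
    have := G.dist_comm (u := b) (v := a)
    have := G.dist_eq_one_iff_adj.2 h
    have h2 := h.symm.reachable.dist_triangle_right o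
    omega
  exact_mod_cast this

/-- Reachability makes `edist` finite on `S`, so the extended cost collapses to a finite real sum.
-/
theorem transportCost_eq_ofReal {G : SimpleGraph V} {S : Finset V}
    (hS : ∀ a ∈ S, ∀ b ∈ S, G.Reachable a b) {π : V → V → ℝ} (h0 : ∀ a b, 0 ≤ π a b)
    (hπ : ∀ a b, (a ∉ S ∨ b ∉ S) → π a b = 0) :
    transportCost G π = ENNReal.ofReal (∑ a ∈ S, ∑ b ∈ S, (G.dist a b : ℝ) * π a b) := by
  have hz : ∀ a b, (a ∉ S ∨ b ∉ S) → (G.edist a b : ℝ≥0∞) * ENNReal.ofReal (π a b) = 0 := by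
    intro a b h
    rw [hπ a b h]
    simp
  unfold transportCost
  rw [tsum_eq_sum (s := S), Finset.sum_comm, ENNReal.ofReal_sum_of_nonneg]
  · refine Finset.sum_congr rfl fun b hb => ?_
    rw [tsum_eq_sum (s := S) fun a ha => hz a b (Or.inl ha), ENNReal.ofReal_sum_of_nonneg]
    · refine Finset.sum_congr rfl fun a ha => ?_
      rw [ENNReal.ofReal_mul (by positivity), ← (hS a ha b hb).coe_dist_eq_edist]
      simp
    · exact fun a _ => mul_nonneg (by positivity) (h0 a b)
  · exact fun b _ => Finset.sum_nonneg fun a _ => mul_nonneg (by positivity) (h0 a b)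
  · intro b hb
    simp [hz _ b (Or.inr hb)]

theorem wasserstein_le_ofReal {G : SimpleGraph V} {S : Finset V}
    (hS : ∀ a ∈ S, ∀ b ∈ S, G.Reachable a b) {μ ν : V → ℝ}
    (μ0 : ∀ a, a ∉ S → μ a = 0) (ν0 : ∀ a, a ∉ S → ν a = 0)
    (hμ : ∀ a, 0 ≤ μ a) (sμ : ∑ a ∈ S, μ a = 1) {π : V → V → ℝ} (h0 : ∀ a b, 0 ≤ π a b)
    (hπ : ∀ a b, (a ∉ S ∨ b ∉ S) → π a b = 0)
    (h1 : ∀ a ∈ S, ∑ b ∈ S, π a b = μ a) (h2 : ∀ b ∈ S, ∑ a ∈ S, π a b = ν b) :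
    wasserstein G μ ν ≤ ENNReal.ofReal (∑ a ∈ S, ∑ b ∈ S, (G.dist a b : ℝ) * π a b) := by
  rw [← transportCost_eq_ofReal hS h0 hπ]
  refine iInf₂_le π ⟨fun a b => ⟨h0 a b, ?_⟩, fun a => ?_, fun b => ?_⟩
  · by_cases h : a ∈ S ∧ b ∈ S
    · calc π a b ≤ ∑ b ∈ S, π a b := Finset.single_le_sum (fun b _ => h0 a b) h.2
        _ = μ a := h1 a h.1
        _ ≤ ∑ a ∈ S, μ a := Finset.single_le_sum (fun a _ => hμ a) h.1
        _ = 1 := sμ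
    · rw [hπ a b (by tauto)]
      exact zero_le_one
  · have : HasSum (fun b => π a b) (∑ b ∈ S, π a b) := hasSum_sum_of_ne_finset_zero
      fun b hb => hπ a b (Or.inr hb)
    by_cases ha : a ∈ S
    · rwa [h1 a ha] at this
    · rw [Finset.sum_eq_zero fun b _ => hπ a b (Or.inl ha)] at this
      rwa [μ0 a ha]
  · have : HasSum (fun a => π a b) (∑ a ∈ S, π a b) := hasSum_sum_of_ne_finset_zero
      fun a ha => hπ a b (Or.inl ha)
    by_cases hb : b ∈ S
    · rwa [h2 b hb] at this
    · rw [Finset.sum_eq_zero fun a _ => hπ a b (Or.inr hb)] at this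
      rwa [ν0 b hb]

/-- Weak duality. -/
theorem ofReal_le_wasserstein {G : SimpleGraph V} {S : Finset V}
    (hS : ∀ a ∈ S, ∀ b ∈ S, G.Reachable a b) {μ ν : V → ℝ}
    (μ0 : ∀ a, a ∉ S → μ a = 0) (ν0 : ∀ a, a ∉ S → ν a = 0)
    {φ : V → ℝ} (hφ : EdgeLipschitz G φ) :
    ENNReal.ofReal (∑ a ∈ S, φ a * μ a - ∑ a ∈ S, φ a * ν a) ≤ wasserstein G μ ν := by
  refine le_iInf₂ fun π hπ => ?_
  obtain ⟨hI, h1, h2⟩ := hπ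
  have h0 : ∀ a b, 0 ≤ π a b := fun a b => (hI a b).1
  have hz : ∀ a b, (a ∉ S ∨ b ∉ S) → π a b = 0 := by
    rintro a b (h | h)
    · have := h1 a
      rw [μ0 a h] at this
      exact congrFun ((hasSum_zero_iff_of_nonneg (h0 a)).1 this) b
    · have := h2 b
      rw [ν0 b h] at this
      exact congrFun ((hasSum_zero_iff_of_nonneg fun a => h0 a b).1 this) a
  have e1 : ∀ a, ∑ b ∈ S, π a b = μ a := fun a =>
    (hasSum_sum_of_ne_finset_zero fun b hb => hz a b (Or.inr hb)).unique (h1 a)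
  have e2 : ∀ b, ∑ a ∈ S, π a b = ν b := fun b =>
    (hasSum_sum_of_ne_finset_zero fun a ha => hz a b (Or.inl ha)).unique (h2 b)
  rw [transportCost_eq_ofReal hS h0 hz]
  refine ENNReal.ofReal_le_ofReal ?_
  have e3 : ∑ a ∈ S, φ a * μ a = ∑ a ∈ S, ∑ b ∈ S, φ a * π a b :=
    Finset.sum_congr rfl fun a _ => by rw [← e1, Finset.mul_sum]
  have e4 : ∑ b ∈ S, φ b * ν b = ∑ a ∈ S, ∑ b ∈ S, φ b * π a b := by
    rw [Finset.sum_comm]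
    exact Finset.sum_congr rfl fun b _ => by rw [← e2, Finset.mul_sum]
  rw [e3, e4, ← Finset.sum_sub_distrib]
  refine Finset.sum_le_sum fun a ha => ?_
  rw [← Finset.sum_sub_distrib]
  refine Finset.sum_le_sum fun b hb => ?_
  rw [← sub_mul]
  exact mul_le_mul_of_nonneg_right (hφ.sub_le_dist (hS a ha b hb)) (h0 a b)

/-- Kantorovich-Rubinstein duality for finitely supported measures. -/
theorem isLUB_wasserstein {G : SimpleGraph V} {S : Finset V}
    (hS : ∀ a ∈ S, ∀ b ∈ S, G.Reachable a b) {μ ν : V → ℝ}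
    (μ0 : ∀ a, a ∉ S → μ a = 0) (ν0 : ∀ a, a ∉ S → ν a = 0)
    (hμ : ∀ a, 0 ≤ μ a) (hν : ∀ a, 0 ≤ ν a) (sμ : ∑ a ∈ S, μ a = 1) (sν : ∑ a ∈ S, ν a = 1) :
    IsLUB ((fun φ : V → ℝ => ∑ a ∈ S, φ a * μ a - ∑ a ∈ S, φ a * ν a) '' {φ | EdgeLipschitz G φ})
      (wasserstein G μ ν).toReal := by
  classical
  constructor
  · rintro _ ⟨φ, hφ, rfl⟩
    -- `toReal` would send `⊤` to `0`; the product coupling shows that the distance is finite.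
    have hfin : wasserstein G μ ν ≠ ⊤ := by
      refine ne_top_of_le_ne_top ENNReal.ofReal_ne_top (wasserstein_le_ofReal hS μ0 ν0 hμ sμ
        (π := fun a b => μ a * ν b) (fun a b => mul_nonneg (hμ a) (hν b)) ?_ ?_ ?_)
      · rintro a b (h | h)
        · simp [μ0 a h]
        · simp [ν0 b h]
      · intro a _
        rw [← Finset.mul_sum, sν, mul_one]
      · intro b _
        rw [← Finset.sum_mul, sμ, one_mul]
    exact (ENNReal.ofReal_le_iff_le_toReal hfin).1 (ofReal_le_wasserstein hS μ0 ν0 hφ)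
  · intro M hM
    have M0 : 0 ≤ M := by
      refine hM ⟨0, fun a b _ => by simp, by simp⟩
    have hne : S.Nonempty := by
      rw [Finset.nonempty_iff_ne_empty]
      rintro rfl
      simp at sμ
    have : Nonempty S := hne.to_subtype
    obtain ⟨π, p0, p1, p2, p3⟩ := exists_coupling_of_dual_le (α := S) (β := S)
      (fun a b => (G.dist a b : ℝ)) (fun a => μ a) (fun a => ν a) M (fun a => hμ a) (fun a => hν a)
      (by rw [Finset.sum_coe_sort S μ]; exact sμ) (by rw [Finset.sum_coe_sort S ν]; exact sν) (by
        intro φ ψ h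
        -- The `c`-transform of `ψ`: a single Lipschitz function with `φ ≤ k ≤ -ψ` on `S`, at least
        -- as good as the dual pair.
        let k : V → ℝ := fun z => Finset.univ.inf' Finset.univ_nonempty
          fun b : S => (G.dist b z : ℝ) - ψ b
        have hk : EdgeLipschitz G k := by
          intro a b hab
          rw [← sub_le_iff_le_add]
          refine Finset.le_inf' _ _ fun c hc => ?_
          have h1 : k a ≤ (G.dist c a : ℝ) - ψ c := Finset.inf'_le _ hc
          have := dist_le_dist_add_one (c : V) hab
          linarith
        have hkφ : ∀ a : S, φ a ≤ k a := by
          intro a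
          refine Finset.le_inf' _ _ fun c hc => ?_
          have := h a c
          rw [SimpleGraph.dist_comm] at this
          linarith
        have hkψ : ∀ b : S, k b ≤ - ψ b := by
          intro b
          have h1 : k b ≤ (G.dist b b : ℝ) - ψ b := Finset.inf'_le _ (Finset.mem_univ b)
          simpa using h1
        refine le_trans ?_ (hM ⟨k, hk, rfl⟩)
        beta_reduce
        rw [sub_eq_add_neg, ← Finset.sum_coe_sort S, ← Finset.sum_coe_sort S,
          ← Finset.sum_neg_distrib]
        refine add_le_add (Finset.sum_le_sum fun a _ => ?_) (Finset.sum_le_sum fun b _ => ?_)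
        · exact mul_le_mul_of_nonneg_right (hkφ a) (hμ a)
        · rw [← neg_mul]
          exact mul_le_mul_of_nonneg_right (by linarith [hkψ b]) (hν b))
    let π' : V → V → ℝ := fun a b => if h : a ∈ S ∧ b ∈ S then π ⟨a, h.1⟩ ⟨b, h.2⟩ else 0
    have hπ' : ∀ a b : S, π' a b = π a b := fun a b => by
      simp [π']
    have hle := wasserstein_le_ofReal hS μ0 ν0 hμ sμ (π := π') (fun a b => by
        dsimp only [π']
        split_ifs
        · exact p0 _ _
        · exact le_rfl) (fun a b h => by
        dsimp only [π']
        rw [dif_neg (by tauto)]) (fun a ha => by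
        rw [← Finset.sum_coe_sort S, ← p1 ⟨a, ha⟩]
        exact Finset.sum_congr rfl fun b _ => hπ' ⟨a, ha⟩ b) (fun b hb => by
        rw [← Finset.sum_coe_sort S, ← p2 ⟨b, hb⟩]
        exact Finset.sum_congr rfl fun a _ => hπ' a ⟨b, hb⟩)
    have hcost : ∑ a ∈ S, ∑ b ∈ S, (G.dist a b : ℝ) * π' a b ≤ M := by
      rw [← Finset.sum_coe_sort S]
      refine le_trans (le_of_eq ?_) p3
      refine Finset.sum_congr rfl fun a _ => ?_
      rw [← Finset.sum_coe_sort S]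
      exact Finset.sum_congr rfl fun b _ => by rw [hπ']
    exact ENNReal.toReal_le_of_le_ofReal M0 (hle.trans (ENNReal.ofReal_le_ofReal hcost))

/-! ### The dual problem for idle measures -/

theorem idleMeasure_nonneg (G : SimpleGraph V) [G.LocallyFinite] {p : ℝ} (hp : p ∈ Icc (0 : ℝ) 1)
    (x z : V) : 0 ≤ idleMeasure G p x z := by
  unfold idleMeasure
  split_ifs
  · exact hp.1
  · exact div_nonneg (by linarith [hp.2]) (by positivity)
  · exact le_rfl

theorem sum_mul_idleMeasure (G : SimpleGraph V) [G.LocallyFinite] (p : ℝ) (x : V) (S : Finset V)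
    (hx : x ∈ S) (hS : G.neighborFinset x ⊆ S) (φ : V → ℝ) :
    ∑ z ∈ S, φ z * idleMeasure G p x z =
      p * φ x + (1 - p) / (G.degree x : ℝ) * ∑ z ∈ G.neighborFinset x, φ z := by
  classical
  have e : ∀ z, φ z * idleMeasure G p x z = (if z = x then p * φ x else 0) +
      if z ∈ G.neighborFinset x then (1 - p) / (G.degree x : ℝ) * φ z else 0 := by
    intro z
    unfold idleMeasure
    simp only [SimpleGraph.mem_neighborFinset]
    by_cases h : z = x
    · subst h
      simp [mul_comm]
    · simp only [h, if_false]
      split_ifs <;> ring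
  rw [Finset.sum_congr rfl fun z _ => e z, Finset.sum_add_distrib, Finset.sum_ite_eq' S x,
    if_pos hx, Finset.sum_ite_mem, Finset.inter_eq_right.2 hS, Finset.mul_sum]

/-- The Kantorovich functional of the measures `μ_x^p`, `μ_y^p` on a `d`-regular graph. -/
noncomputable def dualValue (G : SimpleGraph V) [G.LocallyFinite] (d : ℕ) (p : ℝ) (x y : V) (φ : V → ℝ) : ℝ :=
  p * (φ x - φ y) +
    (1 - p) / (d : ℝ) * (∑ z ∈ G.neighborFinset x, φ z - ∑ z ∈ G.neighborFinset y, φ z)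

/-- Duality on the union of the two closed unit balls, which carries both measures and lies in one
component. -/
theorem isLUB_dualValue {G : SimpleGraph V} [G.LocallyFinite] {d : ℕ}
    (hG : G.IsRegularOfDegree d) {x y : V} (hxy : G.Adj x y) {p : ℝ} (hp : p ∈ Icc (0 : ℝ) 1) :
    IsLUB (dualValue G d p x y '' {φ | EdgeLipschitz G φ}) (1 - ollivierRicci G p x y) := by
  classical
  let S : Finset V := insert x (G.neighborFinset x) ∪ insert y (G.neighborFinset y)
  have hd : (d : ℝ) ≠ 0 := by
    have : 0 < G.degree x := (G.degree_pos_iff_exists_adj x).2 ⟨y, hxy⟩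
    rw [hG x] at this
    positivity
  have hr : ∀ a ∈ S, G.Reachable a x := by
    intro a ha
    simp only [S, Finset.mem_union, Finset.mem_insert, SimpleGraph.mem_neighborFinset] at ha
    rcases ha with (rfl | h) | (rfl | h)
    · rfl
    · exact h.symm.reachable
    · exact hxy.symm.reachable
    · exact h.symm.reachable.trans hxy.symm.reachable
  have hxS : x ∈ S := by simp [S]
  have hyS : y ∈ S := by simp [S]
  have hNx : G.neighborFinset x ⊆ S := fun z hz => by
    simp only [S, Finset.mem_union, Finset.mem_insert]; tauto
  have hNy : G.neighborFinset y ⊆ S := fun z hz => by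
    simp only [S, Finset.mem_union, Finset.mem_insert]; tauto
  have hz : ∀ u ∈ S, G.neighborFinset u ⊆ S → ∀ a, a ∉ S → idleMeasure G p u a = 0 := by
    intro u hu hNu a ha
    unfold idleMeasure
    rw [if_neg (by rintro rfl; exact ha hu), if_neg fun h => ha (hNu (by simpa using h))]
  have hsum : ∀ u ∈ S, G.neighborFinset u ⊆ S → ∑ a ∈ S, idleMeasure G p u a = 1 := by
    intro u hu hNu
    have := sum_mul_idleMeasure G p u S hu hNu 1
    simp only [Pi.one_apply, one_mul, Finset.sum_const, SimpleGraph.card_neighborFinset_eq_degree,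
      hG u, nsmul_eq_mul, mul_one] at this
    rw [this]
    field_simp
    ring
  have := isLUB_wasserstein (fun a ha b hb => (hr a ha).trans (hr b hb).symm)
    (hz x hxS hNx) (hz y hyS hNy) (idleMeasure_nonneg G hp x) (idleMeasure_nonneg G hp y)
    (hsum x hxS hNx) (hsum y hyS hNy)
  convert this using 1
  · refine image_congr fun φ _ => ?_
    rw [sum_mul_idleMeasure G p x S hxS hNx, sum_mul_idleMeasure G p y S hyS hNy, hG x, hG y,
      dualValue]
    ring
  · simp [ollivierRicci]

/-! ### Modifying Lipschitz potentials -/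

theorem EdgeLipschitz.max {G : SimpleGraph V} {φ ψ : V → ℝ} (hφ : EdgeLipschitz G φ)
    (hψ : EdgeLipschitz G ψ) : EdgeLipschitz G fun z => max (φ z) (ψ z) := fun a b h => by
  rw [← max_add_add_right]
  exact max_le_max (hφ a b h) (hψ a b h)

theorem EdgeLipschitz.min {G : SimpleGraph V} {φ ψ : V → ℝ} (hφ : EdgeLipschitz G φ)
    (hψ : EdgeLipschitz G ψ) : EdgeLipschitz G fun z => min (φ z) (ψ z) := fun a b h => by
  rw [← min_add_add_right]
  exact min_le_min (hφ a b h) (hψ a b h)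

theorem EdgeLipschitz.add_const {G : SimpleGraph V} {φ : V → ℝ} (hφ : EdgeLipschitz G φ)
    (c : ℝ) : EdgeLipschitz G fun z => φ z + c := fun a b h => by
  have := hφ a b h
  linarith

theorem EdgeLipschitz.midpoint {G : SimpleGraph V} {φ ψ : V → ℝ} (hφ : EdgeLipschitz G φ)
    (hψ : EdgeLipschitz G ψ) : EdgeLipschitz G fun z => (φ z + ψ z) / 2 := fun a b h => by
  have := hφ a b h
  have := hψ a b h
  linarith

theorem EdgeLipschitz.floor {G : SimpleGraph V} {φ : V → ℝ} (hφ : EdgeLipschitz G φ) :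
    EdgeLipschitz G fun z => (⌊φ z⌋ : ℝ) := fun a b h => by
  have := Int.floor_mono (hφ a b h)
  rw [Int.floor_add_one] at this
  beta_reduce
  exact_mod_cast this

theorem edgeLipschitz_const_add_dist (G : SimpleGraph V) (c : ℝ) (o : V) :
    EdgeLipschitz G fun z => c + (G.dist o z : ℝ) := fun a b h => by
  have := dist_le_dist_add_one o h
  linarith

theorem edgeLipschitz_const_sub_dist (G : SimpleGraph V) (c : ℝ) (o : V) :
    EdgeLipschitz G fun z => c - (G.dist o z : ℝ) := fun a b h => by
  have := dist_le_dist_add_one o h.symm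
  linarith

/-- The difference of the sums of `φ` over the closed unit balls at `x` and `y`. -/
def ballSum (G : SimpleGraph V) [G.LocallyFinite] (x y : V) (φ : V → ℝ) : ℝ :=
  (φ x + ∑ z ∈ G.neighborFinset x, φ z) - (φ y + ∑ z ∈ G.neighborFinset y, φ z)

/-- The common part of the two closed balls, which contains `x` and `y`, cancels; only the private
neighbours count. -/
theorem ballSum_le_ballSum {G : SimpleGraph V} [G.LocallyFinite] {x y : V} (hxy : G.Adj x y)
    {φ ψ : V → ℝ} (h1 : ∀ z, G.Adj x z → z ≠ y → ¬ G.Adj y z → φ z ≤ ψ z)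
    (h2 : ∀ z, G.Adj y z → z ≠ x → ¬ G.Adj x z → ψ z ≤ φ z) :
    ballSum G x y φ ≤ ballSum G x y ψ := by
  classical
  have e : ∀ χ : V → ℝ, ballSum G x y χ =
      ∑ z ∈ insert x (G.neighborFinset x) \ insert y (G.neighborFinset y), χ z -
      ∑ z ∈ insert y (G.neighborFinset y) \ insert x (G.neighborFinset x), χ z := by
    intro χ
    rw [Finset.sum_sdiff_sub_sum_sdiff, Finset.sum_insert (by simp), Finset.sum_insert (by simp),
      ballSum]
  rw [e, e]
  refine sub_le_sub (Finset.sum_le_sum fun z hz => ?_) (Finset.sum_le_sum fun z hz => ?_)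
  · simp only [Finset.mem_sdiff, Finset.mem_insert, SimpleGraph.mem_neighborFinset, not_or] at hz
    refine h1 z (hz.1.resolve_left ?_) hz.2.1 hz.2.2
    rintro rfl
    exact hz.2.2 hxy.symm
  · simp only [Finset.mem_sdiff, Finset.mem_insert, SimpleGraph.mem_neighborFinset, not_or] at hz
    refine h2 z (hz.1.resolve_left ?_) hz.2.1 hz.2.2
    rintro rfl
    exact hz.2.2 hxy

/-- A potential can be moved by at most `1` such that it drops by exactly `1` along the edge
`x ∼ y`, without decreasing its `ballSum`. -/
theorem EdgeLipschitz.exists_sub_eq_one {G : SimpleGraph V} [G.LocallyFinite] {x y : V}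
    (hxy : G.Adj x y) {φ : V → ℝ} (hφ : EdgeLipschitz G φ) :
    ∃ ψ : V → ℝ, EdgeLipschitz G ψ ∧ ψ x - ψ y = 1 ∧ (∀ z, |ψ z - φ z| ≤ 1) ∧
      ballSum G x y φ ≤ ballSum G x y ψ := by
  -- Half of the missing drop: `x` is to be raised by `s` and `y` lowered by `s`.
  obtain ⟨s, hs⟩ : ∃ s, s = (1 - (φ x - φ y)) / 2 := ⟨_, rfl⟩
  have hl := hφ x y hxy
  have hu := hφ y x hxy.symm
  have s0 : 0 ≤ s := by linarith
  have s1 : s ≤ 1 := by linarith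
  have dxy : (G.dist x y : ℝ) = 1 := by exact_mod_cast SimpleGraph.dist_eq_one_iff_adj.2 hxy
  have dyx : (G.dist y x : ℝ) = 1 := by exact_mod_cast SimpleGraph.dist_eq_one_iff_adj.2 hxy.symm
  have hd : ∀ u v z, G.Adj u v → G.Adj u z → z ≠ v → ¬ G.Adj v z → (2 : ℝ) ≤ G.dist v z := by
    intro u v z huv huz hz hvz
    have := (huv.symm.reachable.trans huz.reachable).one_lt_dist_of_ne_of_not_adj hz.symm hvz
    exact_mod_cast this
  -- Cap `φ` by a distance cone that forces `φ y - s` at `y`, lift it above an inverted cone that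
  -- forces `φ x + s` at `x`, and clamp to `[φ - s, φ + s]`. Private neighbours are at distance at
  -- least 2 from the other endpoint, so the cap lowers none of those of `x` and the lift raises
  -- none of those of `y`.
  refine ⟨fun z => Max.max (φ z + -s) (Min.min (φ z + s) (Max.max
    (Min.min (φ z) (φ y - s + (G.dist y z : ℝ))) (φ x + s - (G.dist x z : ℝ)))),
    (hφ.add_const _).max ((hφ.add_const _).min ((hφ.min
      (edgeLipschitz_const_add_dist G _ y)).max (edgeLipschitz_const_sub_dist G _ x))),
    ?_, fun z => ?_, ballSum_le_ballSum hxy (fun z h1 h2 h3 => ?_) fun z h1 h2 h3 => ?_⟩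
  · have ex : Max.max (Min.min (φ x) (φ y - s + (G.dist y x : ℝ)))
        (φ x + s - (G.dist x x : ℝ)) = φ x + s := by
      rw [dyx, SimpleGraph.dist_self, Nat.cast_zero, sub_zero]
      exact max_eq_right ((min_le_left _ _).trans (by linarith))
    have ey : Max.max (Min.min (φ y) (φ y - s + (G.dist y y : ℝ)))
        (φ x + s - (G.dist x y : ℝ)) = φ y - s := by
      rw [dxy, SimpleGraph.dist_self, Nat.cast_zero, add_zero, min_eq_right (by linarith)]
      exact max_eq_left (by linarith)
    beta_reduce
    rw [ex, ey, min_self, max_eq_right (by linarith), min_eq_right (by linarith),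
      max_eq_right (by linarith)]
    linarith
  · rw [abs_le]
    constructor
    · have := le_max_left (φ z + -s) (Min.min (φ z + s) (Max.max
        (Min.min (φ z) (φ y - s + (G.dist y z : ℝ))) (φ x + s - (G.dist x z : ℝ))))
      linarith
    · rw [sub_le_iff_le_add]
      refine max_le (by linarith) ((min_le_left _ _).trans (by linarith))
  · have := hd x y z hxy h1 h2 h3
    have := hφ z x h1.symm
    refine le_max_of_le_right (le_min (by linarith) (le_max_of_le_left (le_min le_rfl ?_)))
    linarith
  · have := hd y x z hxy.symm h1 h2 h3
    have := hφ y z h1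
    refine max_le (by linarith) ((min_le_right _ _).trans (max_le (min_le_left _ _) ?_))
    linarith

/-! ### Rounding potentials to integers -/

theorem intervalIntegrable_floor_add (v : ℝ) :
    IntervalIntegrable (fun θ : ℝ => (⌊v + θ⌋ : ℝ)) MeasureTheory.volume 0 1 := by
  refine Monotone.intervalIntegrable fun a b hab => ?_
  exact_mod_cast Int.floor_mono (by linarith)

/-- The fractional part has period 1 and mean 1/2, which cancels the mean 1/2 of the shift `θ`:
rounding is unbiased on average. -/
theorem integral_floor_add (v : ℝ) : ∫ θ in (0 : ℝ)..1, (⌊v + θ⌋ : ℝ) = v := by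
  have hper : Function.Periodic (Int.fract : ℝ → ℝ) 1 := fun x => Int.fract_add_one x
  have e1 : ∫ θ in (0 : ℝ)..1, Int.fract (v + θ) = 1 / 2 := by
    rw [intervalIntegral.integral_comp_add_left (fun t => Int.fract t) v, add_zero,
      hper.intervalIntegral_add_eq v 0, zero_add]
    have : ∫ t in (0 : ℝ)..1, Int.fract t = ∫ t in (0 : ℝ)..1, t := by
      refine intervalIntegral.integral_congr_Ioo_of_le zero_le_one fun t ht => ?_
      exact Int.fract_eq_self.2 ⟨ht.1.le, ht.2⟩
    rw [this, integral_id]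
    norm_num
  have e2 : ∫ θ in (0 : ℝ)..1, (v + θ) = v + 1 / 2 := by
    rw [intervalIntegral.integral_add (by simp) (by simp)]
    simp
  have hi := intervalIntegrable_floor_add v
  have hv : IntervalIntegrable (fun θ : ℝ => v + θ) MeasureTheory.volume 0 1 :=
    Continuous.intervalIntegrable (by fun_prop) _ _
  have e3 : ∫ θ in (0 : ℝ)..1, Int.fract (v + θ) =
      (∫ θ in (0 : ℝ)..1, (v + θ)) - ∫ θ in (0 : ℝ)..1, (⌊v + θ⌋ : ℝ) := by
    rw [← intervalIntegral.integral_sub hv hi]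
    rfl
  linarith

/-- Rounding down after a suitable shift does not decrease a finitely supported functional. -/
theorem exists_floor_add_ge (S : Finset V) (c φ : V → ℝ) :
    ∃ θ : ℝ, ∑ z ∈ S, c z * φ z ≤ ∑ z ∈ S, c z * (⌊φ z + θ⌋ : ℝ) := by
  by_contra! h
  have hi : IntervalIntegrable (fun θ : ℝ => ∑ z ∈ S, c z * (⌊φ z + θ⌋ : ℝ))
      MeasureTheory.volume 0 1 := by
    have e : (fun θ : ℝ => ∑ z ∈ S, c z * (⌊φ z + θ⌋ : ℝ)) =
        ∑ z ∈ S, fun θ : ℝ => c z * (⌊φ z + θ⌋ : ℝ) := by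
      funext θ
      simp
    rw [e]
    exact IntervalIntegrable.sum S
      fun z _ => (intervalIntegrable_floor_add (φ z)).const_mul (c z)
  have e : ∫ θ in (0 : ℝ)..1, ∑ z ∈ S, c z * (⌊φ z + θ⌋ : ℝ) = ∑ z ∈ S, c z * φ z := by
    rw [intervalIntegral.integral_finsetSum
      fun z _ => (intervalIntegrable_floor_add (φ z)).const_mul (c z)]
    simp only [intervalIntegral.integral_const_mul, integral_floor_add]
  have hlt : ∫ θ in (0 : ℝ)..1, ((∑ z ∈ S, c z * φ z) - ∑ z ∈ S, c z * (⌊φ z + θ⌋ : ℝ)) = 0 := by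
    rw [intervalIntegral.integral_sub (by simp) hi, e]
    simp
  -- If every shift lost strictly, the mean loss would be positive, yet it is zero.
  have := intervalIntegral.intervalIntegral_pos_of_pos
    ((intervalIntegrable_const (c := ∑ z ∈ S, c z * φ z)).sub hi)
    (fun θ => sub_pos.2 (h θ)) zero_lt_one
  simp only [hlt, lt_irrefl] at this

/-- Potentials can be rounded to integer values without decreasing `ballSum - α (φ x - φ y)`. -/
theorem EdgeLipschitz.exists_int {G : SimpleGraph V} [G.LocallyFinite] (x y : V) {φ : V → ℝ}
    (hφ : EdgeLipschitz G φ) (α : ℝ) :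
    ∃ k : V → ℤ, EdgeLipschitz G (fun z => (k z : ℝ)) ∧
      ballSum G x y φ - α * (φ x - φ y) ≤
        ballSum G x y (fun z => (k z : ℝ)) - α * ((k x : ℝ) - k y) ∧
      ∀ n : ℤ, φ x - φ y = n → k x - k y = n := by
  classical
  let S : Finset V := insert x (G.neighborFinset x) ∪ insert y (G.neighborFinset y)
  let c : V → ℝ := fun z => (if z = x then 1 - α else 0) +
    (if z ∈ G.neighborFinset x then 1 else 0) - (if z = y then 1 - α else 0) -
    (if z ∈ G.neighborFinset y then 1 else 0)
  have hxS : x ∈ S := by simp [S]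
  have hyS : y ∈ S := by simp [S]
  have hNx : G.neighborFinset x ⊆ S := fun z hz => by
    simp only [S, Finset.mem_union, Finset.mem_insert]; tauto
  have hNy : G.neighborFinset y ⊆ S := fun z hz => by
    simp only [S, Finset.mem_union, Finset.mem_insert]; tauto
  have e : ∀ χ : V → ℝ, ballSum G x y χ - α * (χ x - χ y) = ∑ z ∈ S, c z * χ z := by
    intro χ
    simp only [c, sub_mul, add_mul, Finset.sum_sub_distrib, Finset.sum_add_distrib, ite_mul,
      zero_mul, one_mul]
    rw [Finset.sum_ite_eq' S x, if_pos hxS, Finset.sum_ite_eq' S y, if_pos hyS,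
      Finset.sum_ite_mem, Finset.sum_ite_mem, Finset.inter_eq_right.2 hNx,
      Finset.inter_eq_right.2 hNy, ballSum]
    ring
  obtain ⟨θ, hθ⟩ := exists_floor_add_ge S c φ
  refine ⟨fun z => ⌊φ z + θ⌋, (hφ.add_const θ).floor, ?_, fun n hn => ?_⟩
  · rw [e, e fun z => (⌊φ z + θ⌋ : ℝ)]
    exact hθ
  · have : φ x + θ = φ y + θ + n := by linarith
    beta_reduce
    rw [this, Int.floor_add_intCast]
    ring

theorem exists_int_ballSum {G : SimpleGraph V} [G.LocallyFinite] (x y : V) (k : V → ℤ) :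
    ∃ n : ℤ, ballSum G x y (fun z => (k z : ℝ)) = n :=
  ⟨(k x + ∑ z ∈ G.neighborFinset x, k z) - (k y + ∑ z ∈ G.neighborFinset y, k z), by
    simp [ballSum]⟩

theorem ballSum_midpoint {G : SimpleGraph V} [G.LocallyFinite] (x y : V) (φ ψ : V → ℝ) :
    ballSum G x y (fun z => (φ z + ψ z) / 2) = (ballSum G x y φ + ballSum G x y ψ) / 2 := by
  simp only [ballSum, ← Finset.sum_div, Finset.sum_add_distrib]
  ring

/-! ### The piecewise affine idleness function -/

/-- Maximizers of `ballSum` and of `ballSum - (φ x - φ y)` can be combined: the value function of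
the intermediate problems is affine. -/
theorem exists_ballSum_sub_mul_ge {G : SimpleGraph V} [G.LocallyFinite] {x y : V}
    (hxy : G.Adj x y) {φ ψ : V → ℝ} (hφ : EdgeLipschitz G φ) (hψ : EdgeLipschitz G ψ)
    {α : ℝ} (h0 : 0 ≤ α) (h1 : α ≤ 1) :
    ∃ χ : V → ℝ, EdgeLipschitz G χ ∧
      (1 - α) * ballSum G x y φ + α * (ballSum G x y ψ - (ψ x - ψ y)) ≤
        ballSum G x y χ - α * (χ x - χ y) := by
  obtain ⟨φ', hφ', ht', -, hS'⟩ := hφ.exists_sub_eq_one hxy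
  obtain ⟨k, hk, hkS, hkt⟩ := hφ'.exists_int x y 0
  have hk1 : (k x : ℝ) - k y = 1 := by exact_mod_cast hkt 1 (by simpa using ht')
  have hSk : ballSum G x y φ ≤ ballSum G x y fun z => (k z : ℝ) := by linarith
  -- it suffices to treat an integral potential with drop `0` or `1`
  have main : ∀ l : V → ℤ, EdgeLipschitz G (fun z => (l z : ℝ)) → (l x - l y = 0 ∨ l x - l y = 1) →
      ballSum G x y ψ - (ψ x - ψ y) ≤ ballSum G x y (fun z => (l z : ℝ)) - ((l x : ℝ) - l y) →
      ∃ χ : V → ℝ, EdgeLipschitz G χ ∧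
      (1 - α) * ballSum G x y φ + α * (ballSum G x y ψ - (ψ x - ψ y)) ≤
        ballSum G x y χ - α * (χ x - χ y) := by
    intro l hl hlt hlS
    obtain ⟨m, hm⟩ := exists_int_ballSum (G := G) x y k
    obtain ⟨n, hn⟩ := exists_int_ballSum (G := G) x y l
    have b1 := mul_le_mul_of_nonneg_left hSk (sub_nonneg.2 h1)
    have b2 := mul_le_mul_of_nonneg_left hlS h0
    rw [hm] at b1
    rw [hn] at b2
    -- If `m ≤ n`, then `l` serves both problems. Otherwise integrality gives `n + 1 ≤ m`, which
    -- pays for the drop 1 of `k`, since `l` has drop at least 0.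
    rcases le_or_gt m n with hmn | hmn
    · have hmn' : (m : ℝ) ≤ n := by exact_mod_cast hmn
      refine ⟨_, hl, ?_⟩
      rw [hn]
      have := mul_le_mul_of_nonneg_left hmn' (sub_nonneg.2 h1)
      linarith
    · have hmn' : (n : ℝ) + 1 ≤ m := by exact_mod_cast hmn
      refine ⟨_, hk, ?_⟩
      rw [hm, hk1]
      have hlt' : (0 : ℝ) ≤ l x - l y := by
        have : 0 ≤ l x - l y := by omega
        exact_mod_cast this
      have := mul_le_mul_of_nonneg_left (show (n : ℝ) - (l x - l y) ≤ m - 1 by linarith) h0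
      linarith
  obtain ⟨l, hl, hlS, -⟩ := hψ.exists_int x y 1
  rw [one_mul, one_mul] at hlS
  have hu : (l x : ℝ) ≤ l y + 1 := hl x y hxy
  have hd : (l y : ℝ) ≤ l x + 1 := hl y x hxy.symm
  norm_cast at hu hd
  by_cases hlt : l x - l y = 0 ∨ l x - l y = 1
  · exact main l hl hlt hlS
  have hlt : l x - l y = -1 := by omega
  have hlt' : (l x : ℝ) - l y = -1 := by exact_mod_cast hlt
  obtain ⟨m, hm⟩ := exists_int_ballSum (G := G) x y k
  obtain ⟨n, hn⟩ := exists_int_ballSum (G := G) x y l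
  rcases le_or_gt m n with hmn | hmn
  · have hmn' : (m : ℝ) ≤ n := by exact_mod_cast hmn
    refine ⟨_, hl, ?_⟩
    rw [hm] at hSk
    rw [hn] at hlS ⊢
    have b1 := mul_le_mul_of_nonneg_left (hSk.trans hmn') (sub_nonneg.2 h1)
    have b2 := mul_le_mul_of_nonneg_left hlS h0
    linarith
  · have hmn' : (n : ℝ) + 1 ≤ m := by exact_mod_cast hmn
    -- The midpoint of drops 1 and -1 has drop 0 and ball sum `(m + n)/2 > n`. Rounding lifts this
    -- to at least `n + 1`, so `r` can replace `l` in `main`.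
    obtain ⟨r, hr, hrS, hrt⟩ := (hk.midpoint hl).exists_int x y 0
    have hr0 : r x - r y = 0 := hrt 0 (by push_cast; linarith)
    have hr0' : (r x : ℝ) - r y = 0 := by exact_mod_cast hr0
    obtain ⟨q, hq⟩ := exists_int_ballSum (G := G) x y r
    rw [ballSum_midpoint x y (fun z => (k z : ℝ)) (fun z => (l z : ℝ)), hm, hn, hq] at hrS
    have hqn : n + 1 ≤ q := by
      have : (n : ℝ) < q := by linarith
      exact_mod_cast this
    have hqn' : (n : ℝ) + 1 ≤ q := by exact_mod_cast hqn
    refine main r hr (Or.inl hr0) (hlS.trans ?_)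
    rw [hn, hq]
    linarith

theorem mul_le_of_isLUB {A : Set ℝ} {M k B : ℝ} (hA : IsLUB A M) (hne : A.Nonempty) (hk : 0 ≤ k)
    (h : ∀ a ∈ A, k * a ≤ B) : k * M ≤ B := by
  rcases hk.eq_or_lt with rfl | hk
  · obtain ⟨a, ha⟩ := hne
    simpa using h a ha
  · rw [← le_div_iff₀' hk]
    exact hA.2 fun a ha => (le_div_iff₀' hk).2 (h a ha)

theorem edgeLipschitz_zero (G : SimpleGraph V) : EdgeLipschitz G 0 := fun a b _ => by simp

theorem dualValue_eq (G : SimpleGraph V) [G.LocallyFinite] (d : ℕ) (p : ℝ) (x y : V) (φ : V → ℝ) :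
    dualValue G d p x y φ =
      (1 - p) / d * ballSum G x y φ + (p - (1 - p) / d) * (φ x - φ y) := by
  unfold dualValue ballSum
  ring

/-- The idleness function of an edge of a regular graph is affine on `[0, 1 / (d + 1)]` and on
`[1 / (d + 1), 1]`. -/
theorem ollivierRicci_piecewise {G : SimpleGraph V} [G.LocallyFinite] {d : ℕ}
    (hG : G.IsRegularOfDegree d) {x y : V} (hxy : G.Adj x y) :
    ∃ κ : ℝ, (∀ p ∈ Icc (1 / ((d : ℝ) + 1)) 1, ollivierRicci G p x y = (1 - p) * κ) ∧
      ∀ p ∈ Icc (0 : ℝ) (1 / ((d : ℝ) + 1)), ollivierRicci G p x y =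
        ollivierRicci G 0 x y + p * (d * κ - (d + 1) * ollivierRicci G 0 x y) := by
  have hd : (0 : ℝ) < d := by
    have : 0 < G.degree x := (G.degree_pos_iff_exists_adj x).2 ⟨y, hxy⟩
    rw [hG x] at this
    exact_mod_cast this
  have p0 : (0 : ℝ) < 1 / ((d : ℝ) + 1) := by positivity
  have p1 : 1 / ((d : ℝ) + 1) < 1 := by
    rw [div_lt_one (by positivity)]
    linarith
  have hne : ∀ F : (V → ℝ) → ℝ, (F '' {φ | EdgeLipschitz G φ}).Nonempty := fun F =>
    ⟨_, 0, edgeLipschitz_zero G, rfl⟩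
  -- At `p = 1/(d+1)` the drop term vanishes, so duality at this idleness supplies the supremum of
  -- `ballSum`.
  obtain ⟨M, hM⟩ : ∃ M, IsLUB (ballSum G x y '' {φ | EdgeLipschitz G φ}) M := by
    refine ⟨(d + 1) * (1 - ollivierRicci G (1 / ((d : ℝ) + 1)) x y), ?_⟩
    have h := isLUB_dualValue hG hxy (p := 1 / ((d : ℝ) + 1)) ⟨p0.le, p1.le⟩
    have e : ∀ φ, ballSum G x y φ = (d + 1) * dualValue G d (1 / ((d : ℝ) + 1)) x y φ := by
      intro φ
      rw [dualValue_eq]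
      field_simp
      ring
    constructor
    · rintro _ ⟨φ, hφ, rfl⟩
      rw [e]
      exact mul_le_mul_of_nonneg_left (h.1 ⟨φ, hφ, rfl⟩) (by positivity)
    · intro B hB
      refine mul_le_of_isLUB h (hne _) (by positivity) ?_
      rintro _ ⟨φ, hφ, rfl⟩
      rw [← e]
      exact hB ⟨φ, hφ, rfl⟩
  have h0 := isLUB_dualValue hG hxy (p := 0) ⟨le_rfl, zero_le_one⟩
  have e0 : ∀ φ, d * dualValue G d 0 x y φ = ballSum G x y φ - (φ x - φ y) := by
    intro φ
    rw [dualValue_eq]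
    field_simp
    ring
  refine ⟨(d + 1 - M) / d, fun p hp => ?_, fun p hp => ?_⟩
  · have hp0 : 0 ≤ 1 - p := sub_nonneg.2 hp.2
    have hc : 0 ≤ p - (1 - p) / d := by
      have := (div_le_iff₀ (by positivity)).1 hp.1
      rw [sub_nonneg, div_le_iff₀ hd]
      linarith
    have h := isLUB_dualValue hG hxy (p := p) ⟨p0.le.trans hp.1, hp.2⟩
    have hW : 1 - ollivierRicci G p x y = (1 - p) / d * M + (p - (1 - p) / d) := by
      apply le_antisymm
      · refine h.2 ?_
        rintro _ ⟨φ, hφ, rfl⟩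
        rw [dualValue_eq]
        have hb := mul_le_mul_of_nonneg_left (hM.1 ⟨φ, hφ, rfl⟩) (div_nonneg hp0 hd.le)
        have := hφ x y hxy
        have := mul_le_mul_of_nonneg_left (show φ x - φ y ≤ 1 by linarith) hc
        linarith
      · rw [← le_sub_iff_add_le]
        refine mul_le_of_isLUB hM (hne _) (div_nonneg hp0 hd.le) ?_
        rintro _ ⟨φ, hφ, rfl⟩
        obtain ⟨ψ, hψ, ht, -, hS⟩ := EdgeLipschitz.exists_sub_eq_one hxy hφ
        have hb := h.1 ⟨ψ, hψ, rfl⟩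
        rw [dualValue_eq, ht] at hb
        have := mul_le_mul_of_nonneg_left hS (div_nonneg hp0 hd.le)
        linarith
    have : ollivierRicci G p x y = 1 - ((1 - p) / d * M + (p - (1 - p) / d)) := by linarith
    rw [this]
    field_simp
    ring
  · have hp1 : 0 < 1 - p := sub_pos.2 (hp.2.trans_lt p1)
    -- Minus the coefficient of the drop; the weights `p` and `q` are nonnegative here, with `p + q
    -- = (1-p)/d`.
    obtain ⟨q, hq⟩ : ∃ q, q = (1 - p) / d - p := ⟨_, rfl⟩
    have hq0 : 0 ≤ q := by
      have := (le_div_iff₀ (by positivity)).1 hp.2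
      rw [hq, sub_nonneg, le_div_iff₀ hd]
      linarith
    have hpq : 0 < p + q := by
      rw [hq, add_sub_cancel]
      positivity
    have h := isLUB_dualValue hG hxy (p := p) ⟨hp.1, hp.2.trans p1.le⟩
    have e : ∀ φ, dualValue G d p x y φ =
        p * ballSum G x y φ + q * (ballSum G x y φ - (φ x - φ y)) := by
      intro φ
      rw [dualValue_eq, hq]
      ring
    have hW : 1 - ollivierRicci G p x y = p * M + q * d * (1 - ollivierRicci G 0 x y) := by
      apply le_antisymm
      · refine h.2 ?_
        rintro _ ⟨φ, hφ, rfl⟩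
        have b1 := mul_le_mul_of_nonneg_left (hM.1 ⟨φ, hφ, rfl⟩) hp.1
        have b2 := mul_le_mul_of_nonneg_left (h0.1 ⟨φ, hφ, rfl⟩) (mul_nonneg hq0 hd.le)
        rw [mul_assoc, e0] at b2
        rw [e]
        linarith
      · rw [← le_sub_iff_add_le]
        refine mul_le_of_isLUB hM (hne _) hp.1 ?_
        rintro _ ⟨φ, hφ, rfl⟩
        rw [le_sub_comm]
        refine mul_le_of_isLUB h0 (hne _) (mul_nonneg hq0 hd.le) ?_
        rintro _ ⟨ψ, hψ, rfl⟩
        rw [mul_assoc, e0, le_sub_iff_add_le']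
        obtain ⟨χ, hχ, hb⟩ := exists_ballSum_sub_mul_ge hxy hφ hψ (α := q / (p + q))
          (by positivity) ((div_le_one hpq).2 (by linarith [hp.1]))
        refine le_trans ?_ (h.1 ⟨χ, hχ, rfl⟩)
        rw [e]
        have := mul_le_mul_of_nonneg_left hb hpq.le
        have e1 : (p + q) * (q / (p + q)) = q := by field_simp
        calc p * ballSum G x y φ + q * (ballSum G x y ψ - (ψ x - ψ y))
            = (p + q) * ((1 - q / (p + q)) * ballSum G x y φ +
              q / (p + q) * (ballSum G x y ψ - (ψ x - ψ y))) := by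
              linear_combination (ballSum G x y φ - (ballSum G x y ψ - (ψ x - ψ y))) * e1
          _ ≤ _ := this
          _ = _ := by linear_combination (-(χ x - χ y)) * e1
    have : ollivierRicci G p x y = 1 - (p * M + q * d * (1 - ollivierRicci G 0 x y)) := by
      linarith
    rw [this, hq]
    field_simp
    ring

theorem tendsto_ollivierRicci_div {G : SimpleGraph V} [G.LocallyFinite] {a κ : ℝ} {x y : V}
    (ha : a < 1) (h : ∀ p ∈ Icc a 1, ollivierRicci G p x y = (1 - p) * κ) :
    Tendsto (fun p : ℝ => ollivierRicci G p x y / (1 - p)) (𝓝[<] (1 : ℝ)) (𝓝 κ) := by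
  refine tendsto_const_nhds.congr' ?_
  filter_upwards [Ioo_mem_nhdsLT ha] with p hp
  have : 1 - p ≠ 0 := (sub_pos.2 hp.2).ne'
  rw [h p ⟨hp.1.le, hp.2.le⟩]
  field_simp

/-! ### Horizontal edges of Cartesian products -/

theorem sum_neighborFinset_boxProd {W : Type*} (G : SimpleGraph V) (H : SimpleGraph W)
    [G.LocallyFinite] [H.LocallyFinite] (x : V) (y : W) (f : V × W → ℝ) :
    ∑ v ∈ (G □ H).neighborFinset (x, y), f v =
      ∑ z ∈ G.neighborFinset x, f (z, y) + ∑ w ∈ H.neighborFinset y, f (x, w) := by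
  rw [SimpleGraph.neighborFinset_boxProd, Finset.sum_disjUnion, Finset.sum_product,
    Finset.sum_product]
  simp

/-- The curvature of a horizontal edge of a product is a multiple of the curvature of its
projection, for another idleness. -/
theorem ollivierRicci_boxProd {W : Type*} {G : SimpleGraph V} {H : SimpleGraph W}
    [G.LocallyFinite] [H.LocallyFinite] {dG dH : ℕ}
    (hG : G.IsRegularOfDegree dG) (hH : H.IsRegularOfDegree dH)
    {x₁ x₂ : V} (hx : G.Adj x₁ x₂) (y : W) {p q c : ℝ} (hp : p ∈ Icc (0 : ℝ) 1)
    (hc : c = p + (1 - p) * dG / (dG + dH)) (hq : c * q = p) :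
    ollivierRicci (G □ H) p (x₁, y) (x₂, y) = c * ollivierRicci G q x₁ x₂ := by
  classical
  have hd : (0 : ℝ) < dG := by
    have : 0 < G.degree x₁ := (G.degree_pos_iff_exists_adj x₁).2 ⟨x₂, hx⟩
    rw [hG x₁] at this
    exact_mod_cast this
  have hreg : (G □ H).IsRegularOfDegree (dG + dH) := by
    intro v
    rw [SimpleGraph.degree_boxProd, hG, hH]
  have hadj : (G □ H).Adj (x₁, y) (x₂, y) := by simpa [SimpleGraph.boxProd_adj] using hx
  have hp1 : 0 ≤ 1 - p := sub_nonneg.2 hp.2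
  have hc1 : c * (1 - q) = (1 - p) * dG / (dG + dH) := by linarith
  have hc0 : 0 < c := by
    rw [hc]
    rcases hp.1.eq_or_lt with rfl | h
    · have : 0 < (1 - 0) * (dG : ℝ) / (dG + dH) := by positivity
      linarith
    · have : 0 ≤ (1 - p) * (dG : ℝ) / (dG + dH) := by positivity
      linarith
  have hqI : q ∈ Icc (0 : ℝ) 1 := by
    constructor
    · exact le_of_mul_le_mul_left (by rw [mul_zero, hq]; exact hp.1) hc0
    · refine le_of_mul_le_mul_left ?_ hc0
      rw [hq, mul_one, hc]
      have : 0 ≤ (1 - p) * (dG : ℝ) / (dG + dH) := by positivity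
      linarith
  have hGq := isLUB_dualValue hG hx hqI
  have hP := isLUB_dualValue hreg hadj hp
  have e : ∀ f : V × W → ℝ, dualValue (G □ H) (dG + dH) p (x₁, y) (x₂, y) f =
      c * dualValue G dG q x₁ x₂ (fun z => f (z, y)) +
        (1 - p) / (dG + dH) * ∑ w ∈ H.neighborFinset y, (f (x₁, w) - f (x₂, w)) := by
    intro f
    have e1 : c * ((1 - q) / dG) = (1 - p) / (dG + dH) := by
      rw [← mul_div_assoc, hc1]
      field_simp
    unfold dualValue
    rw [sum_neighborFinset_boxProd, sum_neighborFinset_boxProd, Finset.sum_sub_distrib,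
      Nat.cast_add]
    linear_combination (-(f (x₁, y) - f (x₂, y))) * hq -
      (∑ z ∈ G.neighborFinset x₁, f (z, y) - ∑ z ∈ G.neighborFinset x₂, f (z, y)) * e1
  have hcoef : 0 ≤ (1 - p) / ((dG : ℝ) + dH) := by positivity
  have hW : 1 - ollivierRicci (G □ H) p (x₁, y) (x₂, y) =
      c * (1 - ollivierRicci G q x₁ x₂) + (1 - p) / (dG + dH) * dH := by
    apply le_antisymm
    · refine hP.2 ?_
      rintro _ ⟨f, hf, rfl⟩
      rw [e]
      refine add_le_add (mul_le_mul_of_nonneg_left (hGq.1 ⟨_, fun a b hab => ?_, rfl⟩) hc0.le)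
        (mul_le_mul_of_nonneg_left ?_ hcoef)
      · exact hf (a, y) (b, y) (by simpa [SimpleGraph.boxProd_adj] using hab)
      · have : ∑ w ∈ H.neighborFinset y, (f (x₁, w) - f (x₂, w)) ≤
            ∑ w ∈ H.neighborFinset y, (1 : ℝ) := by
          refine Finset.sum_le_sum fun w _ => ?_
          have := hf (x₁, w) (x₂, w) (by simpa [SimpleGraph.boxProd_adj] using hx)
          linarith
        simpa [hH y] using this
    · rw [← le_sub_iff_add_le]
      refine mul_le_of_isLUB hGq ⟨_, 0, edgeLipschitz_zero G, rfl⟩ hc0.le ?_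
      rintro _ ⟨φ, hφ, rfl⟩
      obtain ⟨ψ, hψ, ht, hclose, -⟩ := EdgeLipschitz.exists_sub_eq_one hx hφ
      -- `φ` is kept on the fibre over `y`, and `ψ` with drop 1 is used on all others; they differ
      -- by at most 1, so vertical edges are respected.
      have hf : EdgeLipschitz (G □ H) fun v => if v.2 = y then φ v.1 else ψ v.1 := by
        rintro ⟨a, w⟩ ⟨b, w'⟩ hab
        simp only [SimpleGraph.boxProd_adj] at hab
        rcases hab with ⟨hab, rfl⟩ | ⟨hab, rfl⟩
        · dsimp only
          split_ifs
          · exact hφ a b hab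
          · exact hψ a b hab
        · have := abs_le.1 (hclose a)
          dsimp only
          split_ifs <;> linarith
      have hb := hP.1 ⟨_, hf, rfl⟩
      rw [e] at hb
      have hs : ∑ w ∈ H.neighborFinset y, ((if w = y then φ x₁ else ψ x₁) -
          if w = y then φ x₂ else ψ x₂) = dH := by
        rw [Finset.sum_congr rfl fun w hw => by
          have hw' : w ≠ y := fun h => by simp [h] at hw
          rw [if_neg hw', if_neg hw', ht]]
        simp [hH y]
      simp only [hs, if_true] at hb
      linarith
  have hsplit : 1 = c + (1 - p) / (dG + dH) * dH := by
    rw [hc]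
    field_simp
    ring
  linear_combination hsplit - hW

end OllivierRicci

/-! ### The product formula -/

/-- The idleness function of a Cartesian product of regular graphs at a horizontal edge. The first
conjunct says that the limit which defines `κ^G(x₁, x₂)` exists. -/
theorem corollary1p2 {V W : Type*} (G : SimpleGraph V) (H : SimpleGraph W)
    [G.LocallyFinite] [H.LocallyFinite] (dG dH : ℕ)
    (hG : G.IsRegularOfDegree dG) (hH : H.IsRegularOfDegree dH)
    (x₁ x₂ : V) (hx : G.Adj x₁ x₂) (y : W) :
    Tendsto (fun p : ℝ => OllivierRicci.ollivierRicci G p x₁ x₂ / (1 - p)) (𝓝[<] (1 : ℝ))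
      (𝓝 (OllivierRicci.linLuYau G x₁ x₂)) ∧
    (∀ p ∈ Icc (0 : ℝ) (1 / ((dG : ℝ) + dH + 1)),
      OllivierRicci.ollivierRicci (G □ H) p (x₁, y) (x₂, y) =
        (dG : ℝ) / (dG + dH) * OllivierRicci.ollivierRicci G p x₁ x₂ +
          (dG : ℝ) * dH / (dG + dH) *
            (OllivierRicci.linLuYau G x₁ x₂ - OllivierRicci.ollivierRicci G 0 x₁ x₂) * p) ∧
    (∀ p ∈ Icc (1 / ((dG : ℝ) + dH + 1)) (1 : ℝ),
      OllivierRicci.ollivierRicci (G □ H) p (x₁, y) (x₂, y) =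
        (dG : ℝ) / (dG + dH) * OllivierRicci.linLuYau G x₁ x₂ * (1 - p)) := by
  have hd : (0 : ℝ) < dG := by
    have : 0 < G.degree x₁ := (G.degree_pos_iff_exists_adj x₁).2 ⟨x₂, hx⟩
    rw [hG x₁] at this
    exact_mod_cast this
  have p0 : (0 : ℝ) < 1 / ((dG : ℝ) + dH + 1) := by positivity
  have p1 : 1 / ((dG : ℝ) + dH + 1) < 1 := by
    rw [div_lt_one (by positivity)]
    have : (0 : ℝ) ≤ dH := by positivity
    linarith
  have p2 : 1 / ((dG : ℝ) + 1) < 1 := by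
    rw [div_lt_one (by positivity)]
    linarith
  have p3 : 1 / ((dG : ℝ) + dH + 1) ≤ 1 / ((dG : ℝ) + 1) := by
    refine one_div_le_one_div_of_le (by positivity) ?_
    have : (0 : ℝ) ≤ dH := by positivity
    linarith
  obtain ⟨κ, hhigh, hlow⟩ := OllivierRicci.ollivierRicci_piecewise hG hx
  have hlim := OllivierRicci.tendsto_ollivierRicci_div p2 hhigh
  have hκ : OllivierRicci.linLuYau G x₁ x₂ = κ := hlim.limUnder_eq
  rw [hκ]
  have hcpos : ∀ p ∈ Icc (0 : ℝ) 1, 0 < p + (1 - p) * (dG : ℝ) / (dG + dH) := by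
    intro p hp
    rcases hp.1.eq_or_lt with rfl | h
    · have : 0 < (1 - 0) * (dG : ℝ) / (dG + dH) := by positivity
      linarith
    · have : 0 ≤ (1 - p) * (dG : ℝ) / (dG + dH) :=
        div_nonneg (mul_nonneg (sub_nonneg.2 hp.2) hd.le) (by positivity)
      linarith
  refine ⟨hlim, fun p hp => ?_, fun p hp => ?_⟩
  · have hpI : p ∈ Icc (0 : ℝ) 1 := ⟨hp.1, hp.2.trans p1.le⟩
    obtain ⟨c, hc⟩ : ∃ c, c = p + (1 - p) * (dG : ℝ) / (dG + dH) := ⟨_, rfl⟩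
    have hc0 : 0 < c := hc ▸ hcpos p hpI
    have hq : c * (p / c) = p := mul_div_cancel₀ p hc0.ne'
    -- Breakpoints correspond: the claim amounts to `p * dG ≤ c - p = (1-p) * dG / (dG+dH)`, that
    -- is, `p ≤ 1/(dG+dH+1)`.
    have hqle : p / c ≤ 1 / ((dG : ℝ) + 1) := by
      rw [div_le_div_iff₀ hc0 (by positivity), hc]
      have h1 := (le_div_iff₀ (by positivity)).1 hp.2
      have h2 : p ≤ (1 - p) / (dG + dH) := by
        rw [le_div_iff₀ (by positivity)]
        linarith
      have h3 := mul_le_mul_of_nonneg_right h2 hd.le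
      rw [div_mul_eq_mul_div] at h3
      linarith
    rw [OllivierRicci.ollivierRicci_boxProd hG hH hx y hpI hc hq,
      hlow _ ⟨div_nonneg hp.1 hc0.le, hqle⟩, hlow p ⟨hp.1, hp.2.trans p3⟩, mul_add, ← mul_assoc,
      hq, hc]
    field_simp
    ring
  · have hpI : p ∈ Icc (0 : ℝ) 1 := ⟨p0.le.trans hp.1, hp.2⟩
    obtain ⟨c, hc⟩ : ∃ c, c = p + (1 - p) * (dG : ℝ) / (dG + dH) := ⟨_, rfl⟩
    have hc0 : 0 < c := hc ▸ hcpos p hpI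
    have hq : c * (p / c) = p := mul_div_cancel₀ p hc0.ne'
    have hnn : 0 ≤ (1 - p) * (dG : ℝ) / (dG + dH) :=
      div_nonneg (mul_nonneg (sub_nonneg.2 hp.2) hd.le) (by positivity)
    have hqge : 1 / ((dG : ℝ) + 1) ≤ p / c := by
      rw [div_le_div_iff₀ (by positivity) hc0, hc]
      have h1 := (div_le_iff₀ (by positivity)).1 hp.1
      have h2 : (1 - p) / (dG + dH) ≤ p := by
        rw [div_le_iff₀ (by positivity)]
        linarith
      have h3 := mul_le_mul_of_nonneg_right h2 hd.le
      rw [div_mul_eq_mul_div] at h3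
      linarith
    have hqle : p / c ≤ 1 := by
      rw [div_le_one hc0]
      linarith
    rw [OllivierRicci.ollivierRicci_boxProd hG hH hx y hpI hc hq, hhigh _ ⟨hqge, hqle⟩,
      ← mul_assoc, mul_sub, hq, hc]
    ring
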